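/- Let $K$ be a field, $0\le d\le n$, and let $\mathrm{Gr}(d,n)$ be the Grassmannian of $d$-dimensional subspaces of $K^{1\times n}$; write $[X]$ for the row span of a $d\times n$ matrix $X$. Let $GL_n$ act by $g\cdot v=vg^{\mathrm{tr}}$, and denote by $B,B^-\subset GL_n$ and $\mathbf B,\mathbf B^-\subset GL_d$ the subgroups of upper and lower triangular matrices. For $I=\{i_1<\dots<i_d\}\subset\{1,\dots,n\}$ let $e_I$ be the $d\times n$ matrix whose $k$-th row is the $i_k$-th standard basis vector, and put $Z_I^+=B\cdot[e_I]$, $Z_I^-=B^-\cdot[e_I]$. For $I=\{i_1<\dots<i_d\}$ and $J=\{j_1<\dots<j_d\}$ let $R_{I,J}=Z_I^-\cap Z_J^+$ be the open Richardson variety. For $W=[X]\in R_{I,J}$ the matrix $f(W)=(X_I)^{-1}X_J\in GL_d$, where $X_I,X_J$ are the submatrices of $X$ formed by the columns in $I$, $J$, depends only on $W$. For $w\in S_d$, identified with the permutation matrix with entries $1$ at the positions $(w(l),l)$, the Gauss-type stratum is $R^{-}_{I,J,w}=f^{-1}(\mathbf B w\mathbf B^-)\subset R_{I,J}$. Assume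 that $w$ satisfies the monotonicity condition $i_{w(k)}\le j_k$ for all $k\in\{1,\dots,d\}$. The Gauss-type Fukaya diagram of $w$ is the following decoration of the positions of a $d\times n$ matrix. The marked points are $(w(l),j_l)$, $l=1,\dots,d$; equivalently, the marked point in row $k$ is $(k,j_{w^{-1}(k)})$. The $\mathbb G_m$-nodes are the marked points $(k,j_{w^{-1}(k)})$ with $i_k\ne j_{w^{-1}(k)}$. The $\mathbb A^1$-nodes are the positions $(k,l)$ with $i_k<l<j_{w^{-1}(k)}$ for which there is no marked point $(k',l)$ with $k'>k$. Let $\alpha$ and $\beta$ be the numbers of $\mathbb G_m$-nodes and $\mathbb A^1$-nodes. Then there is an isomorphism of varieties $$R^{-}_{I,J,w}\;\cong\;(\mathbb G_m)^{\alpha}\times(\mathbb A^1)^{\beta}.$$ More precisely, defining $R^-_{I,J,w}(R)$ for every commutative $K$-algebra $R$ by the same formulas over $R$ (with direct summands of $R^{1\times n}$ of constant rank $d$ in place of $d$-dimensional subspaces), there are bijections $\Phi_R: R^{-}_{I,J,w}(R)\to (R^\times)^\alpha\times R^\beta$, natural in $R$, such that $\Phi_K$ is an isomorphism of classical varieties: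 a homeomorphism for the Zariski topologies on the $K$-points that identifies the regular functions on corresponding open subsets. Here the Grassmannian carries the quotient structure of the full rank $d\times n$ matrices modulo $GL_d$, and the stratum carries the induced structure. -/

import Mathlib

universe u

namespace GaussStrata

/-! ### Spaces with functions

A set with a topology and, for each (open) subset `U`, the notion of a `K`-valued function being
regular on `U`.  Functions are total, and only their values on `U` matter.  This is the classical
language of varieties over `K`, in terms of their sets of `K`-rational points. -/

/-- A topology on `X`, and which functions are regular on which (open) subsets of `X`. -/
structure SpaceWithFunctions (K X : Type*) where
  top : TopologicalSpace X
  RegularOn : Set X → (X → K) → Prop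

/-- Affine space with coordinates indexed by `ι`: the Zariski topology (generated by the
non-vanishing loci of polynomials), and functions that are locally quotients of polynomials. -/
def affineSpace (K : Type*) [Field K] (ι : Type*) : SpaceWithFunctions K (ι → K) where
  top := TopologicalSpace.generateFrom
    {U | ∃ P : MvPolynomial ι K, U = {x | MvPolynomial.eval x P ≠ 0}}
  RegularOn U f := ∀ x ∈ U, ∃ P Q : MvPolynomial ι K, MvPolynomial.eval x Q ≠ 0 ∧
    ∀ y ∈ U, MvPolynomial.eval y Q ≠ 0 →
      f y = MvPolynomial.eval y P / MvPolynomial.eval y Q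

/-- The structure on a (locally closed) subset `Y`: the subspace topology, and functions that
locally extend to regular functions on open subsets of the ambient space. -/
def SpaceWithFunctions.restrict {K X : Type*} (A : SpaceWithFunctions K X) (Y : Set X) :
    SpaceWithFunctions K Y where
  top := A.top.induced Subtype.val
  RegularOn U f := ∀ y ∈ U, ∃ (V : Set X) (g : X → K), @IsOpen X A.top V ∧ y.1 ∈ V ∧
    A.RegularOn V g ∧ ∀ z ∈ U, z.1 ∈ V → f z = g z.1

/-- The quotient structure along a map `p`: a subset is open iff its preimage is, and a function
is regular iff its pullback is. -/
def SpaceWithFunctions.quotient {K X Y : Type*} (A : SpaceWithFunctions K X) (p : X → Y) :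
    SpaceWithFunctions K Y where
  top := A.top.coinduced p
  RegularOn U f := A.RegularOn (p ⁻¹' U) (f ∘ p)

/-- A bijection is an isomorphism if it is a homeomorphism and identifies the regular functions
on corresponding open subsets. -/
def IsIsomorphism {K X Y : Type*} (A : SpaceWithFunctions K X) (B : SpaceWithFunctions K Y)
    (e : X ≃ Y) : Prop :=
  (∀ U : Set Y, @IsOpen Y B.top U ↔ @IsOpen X A.top (e ⁻¹' U)) ∧
  ∀ U : Set Y, @IsOpen Y B.top U → ∀ f : Y → K,
    B.RegularOn U f ↔ A.RegularOn (e ⁻¹' U) (f ∘ e)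

/-! ### Grassmannians -/

/-- The span of the rows of a matrix, denoted `[X]` in comments. -/
def rowSpan {R : Type*} [CommRing R] {d n : ℕ} (X : Matrix (Fin d) (Fin n) R) :
    Submodule R (Fin n → R) :=
  Submodule.span R (Set.range fun a => X a)

/-- The `R`-points of the Grassmannian `Gr(d,n)`: direct summands of `Rⁿ` of constant rank `d`.
If `R` is a field, these are the `d`-dimensional subspaces of `Rⁿ`. -/
def Grassmannian (R : Type*) [CommRing R] (d n : ℕ) : Type _ :=
  {W : Submodule R (Fin n → R) //
    (∃ C : Submodule R (Fin n → R), IsCompl W C) ∧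
      ∀ p : PrimeSpectrum R, Module.rankAtStalk W p = d}

/-- Over a field, a subspace is a point of the Grassmannian iff it has dimension `d`. -/
theorem mem_grassmannian_iff {K : Type*} [Field K] {d n : ℕ} (W : Submodule K (Fin n → K)) :
    ((∃ C : Submodule K (Fin n → K), IsCompl W C) ∧
      ∀ p : PrimeSpectrum K, Module.rankAtStalk W p = d) ↔ Module.finrank K W = d := by
  rw [Module.rankAtStalk_eq_finrank_of_free]
  constructor
  · intro h
    exact h.2 ⊥
  · intro h
    exact ⟨W.exists_isCompl, fun _ => h⟩

/-- The matrices in `K^{d × n}` of full rank `d`, as a subset of the affine space `K^{d × n}`. -/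
def fullRank (K : Type*) [Field K] (d n : ℕ) : Set (Fin d × Fin n → K) :=
  {x | LinearIndependent K fun a : Fin d => fun b : Fin n => x (a, b)}

/-- The map `X ↦ [X]` from full rank matrices to the Grassmannian. -/
def fullRankToGrassmannian (K : Type*) [Field K] (d n : ℕ) (x : fullRank K d n) :
    Grassmannian K d n :=
  ⟨rowSpan (Matrix.of fun a b => x.1 (a, b)), by
    rw [mem_grassmannian_iff]
    have h : LinearIndependent K fun a : Fin d => fun b : Fin n => x.1 (a, b) := x.2
    have h' := finrank_span_eq_card h
    rw [Fintype.card_fin] at h'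
    exact h'⟩

/-- The Grassmannian over a field as a variety: the quotient of the open subset of full rank
matrices in `K^{d × n}` by the left action of `GL_d`. -/
def grassmannianVariety (K : Type*) [Field K] (d n : ℕ) :
    SpaceWithFunctions K (Grassmannian K d n) :=
  ((affineSpace K (Fin d × Fin n)).restrict (fullRank K d n)).quotient
    (fullRankToGrassmannian K d n)

/-- Membership in the Borel subgroup of upper triangular matrices in `GL_m(R)`. -/
def IsUpper {R : Type*} [CommRing R] {m : ℕ} (g : GL (Fin m) R) : Prop :=
  ∀ a b : Fin m, b < a → (g : Matrix (Fin m) (Fin m) R) a b = 0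

/-- Membership in the opposite Borel subgroup of lower triangular matrices in `GL_m(R)`. -/
def IsLower {R : Type*} [CommRing R] {m : ℕ} (g : GL (Fin m) R) : Prop :=
  ∀ a b : Fin m, a < b → (g : Matrix (Fin m) (Fin m) R) a b = 0

/-- The action of `GL_n(R)` on submodules of `Rⁿ` (row vectors) induced by `g • v = v gᵀ`. -/
def glAct {R : Type*} [CommRing R] {n : ℕ} (g : GL (Fin n) R)
    (W : Submodule R (Fin n → R)) : Submodule R (Fin n → R) :=
  W.map (Matrix.vecMulLinear (g : Matrix (Fin n) (Fin n) R).transpose)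

/-! Subsets `I = {i₁ < ⋯ < i_d}` of the index set of columns are given by their increasing
enumerations `i : Fin d ↪o Fin n`; all indices start at `0`. -/

/-- The matrix `e_I` whose `a`-th row is the `i_a`-th standard basis vector. -/
def eMatrix (R : Type*) [CommRing R] {d n : ℕ} (i : Fin d ↪o Fin n) :
    Matrix (Fin d) (Fin n) R :=
  Matrix.of fun a b => if b = i a then 1 else 0

/-- The Bruhat cell `Z_I⁺ = B · [e_I]`. -/
def bruhatPos (R : Type*) [CommRing R] {d n : ℕ} (i : Fin d ↪o Fin n) :
    Set (Grassmannian R d n) :=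
  {W | ∃ g : GL (Fin n) R, IsUpper g ∧ W.1 = glAct g (rowSpan (eMatrix R i))}

/-- The opposite Bruhat cell `Z_I⁻ = B⁻ · [e_I]`. -/
def bruhatNeg (R : Type*) [CommRing R] {d n : ℕ} (i : Fin d ↪o Fin n) :
    Set (Grassmannian R d n) :=
  {W | ∃ g : GL (Fin n) R, IsLower g ∧ W.1 = glAct g (rowSpan (eMatrix R i))}

/-- The open Richardson variety `Z_I⁻ ∩ Z_J⁺`. -/
def richardson (R : Type*) [CommRing R] {d n : ℕ} (i j : Fin d ↪o Fin n) :
    Set (Grassmannian R d n) :=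
  bruhatNeg R i ∩ bruhatPos R j

/-- The permutation matrix of `w`, with entries `1` at the positions `(w l, l)`. -/
def permMat (R : Type*) [CommRing R] {d : ℕ} (w : Equiv.Perm (Fin d)) :
    Matrix (Fin d) (Fin d) R :=
  Matrix.of fun a b => if a = w b then 1 else 0

/-- The double coset `B w B⁻` in `GL_d(R)`, as a set of matrices. -/
def doubleCoset (R : Type*) [CommRing R] {d : ℕ} (w : Equiv.Perm (Fin d)) :
    Set (Matrix (Fin d) (Fin d) R) :=
  {A | ∃ b c : GL (Fin d) R, IsUpper b ∧ IsLower c ∧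
    A = (b : Matrix (Fin d) (Fin d) R) * permMat R w * (c : Matrix (Fin d) (Fin d) R)}

/-- The base change matrix `X_I⁻¹ X_J`, where `X_I`, `X_J` are the submatrices of `X` formed by
the columns in `I` and `J`.  For `[X] = W` in the open Richardson variety, `X_I` is invertible and
this matrix depends only on `W`. -/
noncomputable def baseChangeMatrix {R : Type*} [CommRing R] {d n : ℕ} (i j : Fin d ↪o Fin n)
    (X : Matrix (Fin d) (Fin n) R) : Matrix (Fin d) (Fin d) R :=
  (X.submatrix id i)⁻¹ * X.submatrix id j

/-- The Gauss-type stratum: the preimage of `B w B⁻` under the base change map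
`W = [X] ↦ X_I⁻¹ X_J` on the open Richardson variety. -/
def gaussStratum (R : Type*) [CommRing R] {d n : ℕ} (i j : Fin d ↪o Fin n)
    (w : Equiv.Perm (Fin d)) : Set (Grassmannian R d n) :=
  {W | W ∈ richardson R i j ∧ ∃ X : Matrix (Fin d) (Fin n) R,
    rowSpan X = W.1 ∧ baseChangeMatrix i j X ∈ doubleCoset R w}

/-- The Gauss-type stratum over a field as a subvariety of the Grassmannian. -/
def gaussStratumVariety (K : Type*) [Field K] {d n : ℕ} (i j : Fin d ↪o Fin n)
    (w : Equiv.Perm (Fin d)) : SpaceWithFunctions K (gaussStratum K i j w) :=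
  (grassmannianVariety K d n).restrict (gaussStratum K i j w)

/-- Extension of scalars along `f : R → R'`: the submodule of `R'ⁿ` spanned by the image of `W`. -/
def extendScalars {R R' : Type*} [CommRing R] [CommRing R'] (f : R →+* R') {n : ℕ}
    (W : Submodule R (Fin n → R)) : Submodule R' (Fin n → R') :=
  Submodule.span R' ((fun v : Fin n → R => f ∘ v) '' W)

/-! ### The product of copies of the multiplicative group and the affine line -/

/-- The `R`-points of `𝔾ₘ^α × 𝔸^β`: tuples whose first `α` entries are invertible. -/
def gmTimesA (R : Type*) [CommRing R] (α β : ℕ) : Set (Fin α ⊕ Fin β → R) :=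
  {x | ∀ a : Fin α, IsUnit (x (Sum.inl a))}

/-- The variety `𝔾ₘ^α × 𝔸^β` over a field, as an open subset of `𝔸^(α+β)`. -/
def gmTimesAVariety (K : Type*) [Field K] (α β : ℕ) :
    SpaceWithFunctions K (gmTimesA K α β) :=
  (affineSpace K (Fin α ⊕ Fin β)).restrict (gmTimesA K α β)

/-! ### Fukaya diagrams

Positions `(k, l) : Fin d × Fin n` are aligned to a `d × n` matrix, with row `0` on top. -/

/-- The permutations satisfying the monotonicity condition. -/
def monotonePerms {d n : ℕ} (i j : Fin d ↪o Fin n) : Set (Equiv.Perm (Fin d)) :=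
  {w | ∀ l : Fin d, i (w l) ≤ j l}

/-- The marked points of the matched Fukaya diagram of `w`: the intersection points `(w l, j_l)`
of the strand of `i_{w l}`, running to the right in row `w l`, with the vertical strand of `j_l`. -/
def markedPoints {d n : ℕ} (j : Fin d ↪o Fin n) (w : Equiv.Perm (Fin d)) :
    Finset (Fin d × Fin n) :=
  Finset.univ.image fun l : Fin d => (w l, j l)

/-- The `𝔾ₘ`-nodes of the Gauss-type Fukaya diagram: marked points on strands that start at
different points. -/
def gmNodes {d n : ℕ} (i j : Fin d ↪o Fin n) (w : Equiv.Perm (Fin d)) :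
    Finset (Fin d × Fin n) :=
  (markedPoints j w).filter fun p => i p.1 ≠ j (w⁻¹ p.1)

/-- The `𝔸¹`-nodes of the Gauss-type Fukaya diagram: in row `k`, the positions strictly between
`(k, i_k)` and the marked point of that row, except those with a marked point below them in the
same column. -/
def a1Nodes {d n : ℕ} (i j : Fin d ↪o Fin n) (w : Equiv.Perm (Fin d)) :
    Finset (Fin d × Fin n) :=
  Finset.univ.filter fun p =>
    (i p.1 < p.2 ∧ p.2 < j (w⁻¹ p.1)) ∧ ¬ ∃ k' : Fin d, p.1 < k' ∧ (k', p.2) ∈ markedPoints j w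

end GaussStrata

/-! Every point of the stratum is the row span of exactly one matrix in normal form: row `k` lives
on the interval from `i k` to `j (w⁻¹ k)`, starts with `1`, ends with a unit, and vanishes in the
column of every marked point of a lower row. The remaining entries are free and sit exactly at the
nodes, those at the `𝔾ₘ`-nodes being units; monotonicity makes the intervals nonempty.

Existence (`exists_isIntervalMatrix`, `exists_isNormalForm`): the cell `Z_I⁻` gives a representative
`X₁` whose rows start at the `i k`, and `Z_J⁺` gives `X₂` whose rows end at the `j l`. The condition
`X_I⁻¹ X_J = b w c` turns into `U X₁ = w V X₂` with `U` upper and `V` lower triangular. The left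
side shows where each row starts, the right side where it ends. Row operations then clear the
columns above the marked points, and a diagonal matrix normalizes the left ends.

Uniqueness (`apply_mul_denominatorMinor`): on the columns `i b` for `b ≤ k` and `j (w⁻¹ b)` for `b >
k`, row `k` of a normal form is a standard basis vector. By Cramer's rule its entries are quotients
of maximal minors of any matrix with the same row span.

All this works over every commutative ring, hence is natural. Over a field, the quotients of minors
show that the coordinates are regular, while the normal form, with entries coordinates, `0` or `1`,
is a polynomial section of the quotient map over the stratum and shows the same of the inverse. -/

namespace GaussStrata

/-! ### Row spans -/

section RowSpan

variable {R : Type*} [CommRing R] {d n : ℕ}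

theorem mem_rowSpan_iff {X : Matrix (Fin d) (Fin n) R} {v : Fin n → R} :
    v ∈ rowSpan X ↔ ∃ c : Fin d → R, Matrix.vecMul c X = v := by
  rw [rowSpan, Submodule.mem_span_range_iff_exists_fun]
  simp only [Matrix.vecMul_eq_sum]

theorem row_mem_rowSpan (X : Matrix (Fin d) (Fin n) R) (a : Fin d) : X a ∈ rowSpan X :=
  Submodule.subset_span ⟨a, rfl⟩

theorem rowSpan_le_iff {X Y : Matrix (Fin d) (Fin n) R} :
    rowSpan X ≤ rowSpan Y ↔ ∃ h : Matrix (Fin d) (Fin d) R, X = h * Y := by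
  constructor
  · intro hle
    choose c hc using fun a => mem_rowSpan_iff.1 (hle (row_mem_rowSpan X a))
    refine ⟨Matrix.of c, ?_⟩
    ext a l
    rw [Matrix.mul_apply_eq_vecMul]
    exact (congrFun (hc a) l).symm
  · rintro ⟨h, rfl⟩
    rw [rowSpan, Submodule.span_le]
    rintro _ ⟨a, rfl⟩
    exact mem_rowSpan_iff.2 ⟨h a, (Matrix.mul_apply_eq_vecMul h Y a).symm⟩

theorem rowSpan_mul_of_isUnit {h : Matrix (Fin d) (Fin d) R} (hh : IsUnit h.det)
    (X : Matrix (Fin d) (Fin n) R) : rowSpan (h * X) = rowSpan X := by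
  refine le_antisymm (rowSpan_le_iff.2 ⟨h, rfl⟩) (rowSpan_le_iff.2 ⟨h⁻¹, ?_⟩)
  rw [← Matrix.mul_assoc, Matrix.nonsing_inv_mul _ hh, Matrix.one_mul]

theorem rowSpan_submatrix_equiv (X : Matrix (Fin d) (Fin n) R) (w : Equiv.Perm (Fin d)) :
    rowSpan (X.submatrix w id) = rowSpan X := by
  rw [rowSpan, rowSpan]
  congr 1
  exact w.surjective.range_comp (fun a => X a)

theorem submatrix_cols_mul {e : ℕ} (h : Matrix (Fin d) (Fin d) R) (X : Matrix (Fin d) (Fin n) R)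
    (c : Fin e → Fin n) : (h * X).submatrix id c = h * X.submatrix id c := by
  ext a b
  simp [Matrix.mul_apply]

theorem glAct_rowSpan (g : GL (Fin n) R) (X : Matrix (Fin d) (Fin n) R) :
    glAct g (rowSpan X) = rowSpan (X * (g : Matrix (Fin n) (Fin n) R).transpose) := by
  rw [glAct, rowSpan, Submodule.map_span, rowSpan, ← Set.range_comp]
  congr 2

theorem eMatrix_mul_transpose_apply (i : Fin d ↪o Fin n) (g : Matrix (Fin n) (Fin n) R)
    (a : Fin d) (l : Fin n) : (eMatrix R i * g.transpose) a l = g l (i a) := by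
  simp [eMatrix, Matrix.mul_apply]

theorem permMat_mul_apply {e : ℕ} (w : Equiv.Perm (Fin d)) (M : Matrix (Fin d) (Fin e) R)
    (a : Fin d) (l : Fin e) : (permMat R w * M) a l = M (w⁻¹ a) l := by
  rw [Matrix.mul_apply, Finset.sum_eq_single (w⁻¹ a)]
  · simp [permMat]
  · intro b _ hb
    have : a ≠ w b := fun h => hb (by simp [h])
    simp [permMat, this]
  · simp

theorem extendScalars_rowSpan {R' : Type*} [CommRing R'] (f : R →+* R')
    (X : Matrix (Fin d) (Fin n) R) : extendScalars f (rowSpan X) = rowSpan (X.map f) := by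
  apply le_antisymm
  · rw [extendScalars, Submodule.span_le]
    rintro _ ⟨v, hv, rfl⟩
    obtain ⟨c, rfl⟩ := mem_rowSpan_iff.1 hv
    refine mem_rowSpan_iff.2 ⟨f ∘ c, ?_⟩
    ext l
    simp [Matrix.vecMul, dotProduct]
  · rw [rowSpan, Submodule.span_le]
    rintro _ ⟨a, rfl⟩
    exact Submodule.subset_span ⟨X a, row_mem_rowSpan X a, rfl⟩

theorem linearIndependent_rows (X : Matrix (Fin d) (Fin n) R) (c : Fin d → Fin n)
    (hX : IsUnit (X.submatrix id c).det) : LinearIndependent R fun a => X a := by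
  rw [Fintype.linearIndependent_iff]
  intro x hx a
  have h0 : Matrix.vecMul x X = 0 := by rw [Matrix.vecMul_eq_sum]; exact hx
  have h1 : Matrix.vecMul x (X.submatrix id c) = 0 := by
    ext b
    exact congrFun h0 (c b)
  have h2 : Matrix.vecMul (Matrix.vecMul x (X.submatrix id c)) (X.submatrix id c)⁻¹ = 0 := by
    rw [h1, Matrix.zero_vecMul]
  rw [Matrix.vecMul_vecMul, Matrix.mul_nonsing_inv _ hX, Matrix.vecMul_one] at h2
  exact congrFun h2 a

/-- The row span of a matrix with an invertible maximal minor is a point of the Grassmannian. -/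
theorem rowSpan_mem_grassmannian (X : Matrix (Fin d) (Fin n) R) (c : Fin d → Fin n)
    (hX : IsUnit (X.submatrix id c).det) :
    (∃ C : Submodule R (Fin n → R), IsCompl (rowSpan X) C) ∧
      ∀ p : PrimeSpectrum R, Module.rankAtStalk (rowSpan X) p = d := by
  have hcoord : ∀ x : Fin d → R, Matrix.vecMul x X ∘ c = Matrix.vecMul x (X.submatrix id c) := by
    intro x
    ext b
    simp [Matrix.vecMul, dotProduct]
  constructor
  · let L : (Fin n → R) →ₗ[R] (Fin n → R) :=
      (Matrix.vecMulLinear ((X.submatrix id c)⁻¹ * X)).comp (LinearMap.funLeft R R c)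
    have hL : ∀ v, L v = Matrix.vecMul (Matrix.vecMul (v ∘ c) (X.submatrix id c)⁻¹) X := by
      intro v
      simp only [L, LinearMap.comp_apply, Matrix.vecMulLinear_apply, Matrix.vecMul_vecMul]
      rfl
    have hmem : ∀ v, L v ∈ rowSpan X := fun v => mem_rowSpan_iff.2 ⟨_, (hL v).symm⟩
    refine ⟨_, LinearMap.isCompl_of_proj (f := L.codRestrict (rowSpan X) hmem) ?_⟩
    rintro ⟨v, hv⟩
    apply Subtype.ext
    obtain ⟨x, rfl⟩ := mem_rowSpan_iff.1 hv
    rw [LinearMap.codRestrict_apply, hL, hcoord, Matrix.vecMul_vecMul x (X.submatrix id c),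
      Matrix.mul_nonsing_inv _ hX, Matrix.vecMul_one]
  · intro p
    have : Nontrivial R := p.nontrivial
    have hli := linearIndependent_rows X c hX
    have hb := Module.Basis.span hli
    change Module.rankAtStalk (Submodule.span R (Set.range fun a => X a)) p = d
    have := Module.Free.of_basis hb
    have := Module.Finite.of_basis hb
    rw [Module.rankAtStalk_eq_finrank_of_free]
    simpa using Module.finrank_eq_card_basis hb

end RowSpan

/-! ### Triangular matrices -/

section Triangular

variable {R : Type*} [CommRing R] {d n : ℕ}

theorem mul_apply_eq_of_forall_ne {u : Matrix (Fin d) (Fin d) R} {X : Matrix (Fin d) (Fin n) R}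
    {a : Fin d} {l : Fin n} (h : ∀ b, b ≠ a → u a b = 0 ∨ X b l = 0) :
    (u * X) a l = u a a * X a l := by
  rw [Matrix.mul_apply, Finset.sum_eq_single a]
  · intro b _ hb
    rcases h b hb with h | h <;> simp [h]
  · simp

/-- The determinant of a matrix that becomes upper triangular after simultaneously reordering
rows and columns. -/
theorem det_of_blockTriangular_injective {M : Matrix (Fin d) (Fin d) R} {σ : Fin d → ℕ}
    (hσ : Function.Injective σ) (hM : ∀ a b, σ b < σ a → M a b = 0) : M.det = ∏ a, M a a := by
  -- Pulling the order back along `σ` makes the matrix upper triangular without permuting anything.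
  let _ : LinearOrder (Fin d) := LinearOrder.lift' σ hσ
  convert Matrix.det_of_isUpperTriangular (M := M) ?_
  intro a b h
  exact hM a b h

theorem isUnit_det_of_upper {M : Matrix (Fin d) (Fin d) R} (hM : ∀ a b, b < a → M a b = 0)
    (hu : ∀ a, IsUnit (M a a)) : IsUnit M.det := by
  rw [det_of_blockTriangular_injective (σ := fun a => (a : ℕ)) Fin.val_injective hM]
  exact (IsUnit.prod_univ_iff).2 hu

theorem isUnit_det_of_lower {M : Matrix (Fin d) (Fin d) R} (hM : ∀ a b, a < b → M a b = 0)
    (hu : ∀ a, IsUnit (M a a)) : IsUnit M.det := by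
  rw [← Matrix.det_transpose]
  exact isUnit_det_of_upper (fun a b h => hM b a h) hu

theorem isUnit_diag_of_upper {M : Matrix (Fin d) (Fin d) R} (hM : ∀ a b, b < a → M a b = 0)
    (h : IsUnit M.det) (a : Fin d) : IsUnit (M a a) := by
  rw [det_of_blockTriangular_injective (σ := fun a => (a : ℕ)) Fin.val_injective hM] at h
  exact (IsUnit.prod_univ_iff).1 h a

theorem isUnit_diag_of_lower {M : Matrix (Fin d) (Fin d) R} (hM : ∀ a b, a < b → M a b = 0)
    (h : IsUnit M.det) (a : Fin d) : IsUnit (M a a) := by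
  rw [← Matrix.det_transpose] at h
  exact isUnit_diag_of_upper (M := M.transpose) (fun a b h => hM b a h) h a

theorem inv_upper {M : Matrix (Fin d) (Fin d) R} (hM : ∀ a b, b < a → M a b = 0)
    (h : IsUnit M.det) : ∀ a b, b < a → M⁻¹ a b = 0 := by
  have : Invertible M := Matrix.invertibleOfIsUnitDet M h
  exact fun a b hab => Matrix.blockTriangular_inv_of_blockTriangular (b := id) (M := M)
    (fun a b h => hM a b h) hab

theorem inv_lower {M : Matrix (Fin d) (Fin d) R} (hM : ∀ a b, a < b → M a b = 0)
    (h : IsUnit M.det) : ∀ a b, a < b → M⁻¹ a b = 0 := by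
  intro a b hab
  have := inv_upper (M := M.transpose) (fun a b h => hM b a h)
    (by rwa [Matrix.det_transpose]) b a hab
  rwa [← Matrix.transpose_nonsing_inv] at this

theorem mul_upper {M N : Matrix (Fin d) (Fin d) R} (hM : ∀ a b, b < a → M a b = 0)
    (hN : ∀ a b, b < a → N a b = 0) : ∀ a b, b < a → (M * N) a b = 0 := by
  intro a b hab
  rw [Matrix.mul_apply]
  refine Finset.sum_eq_zero fun c _ => ?_
  rcases lt_or_ge c a with h | h
  · simp [hM a c h]
  · simp [hN c b (hab.trans_le h)]

theorem mul_lower {M N : Matrix (Fin d) (Fin d) R} (hM : ∀ a b, a < b → M a b = 0)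
    (hN : ∀ a b, a < b → N a b = 0) : ∀ a b, a < b → (M * N) a b = 0 := by
  intro a b hab
  rw [Matrix.mul_apply]
  refine Finset.sum_eq_zero fun c _ => ?_
  rcases lt_or_ge a c with h | h
  · simp [hM a c h]
  · simp [hN c b (h.trans_lt hab)]

theorem isUnit_det_coe (g : GL (Fin d) R) : IsUnit (g : Matrix (Fin d) (Fin d) R).det :=
  (Matrix.isUnit_iff_isUnit_det _).1 g.isUnit

end Triangular

/-! ### Matrices supported on the intervals of a monotone permutation -/

section Interval

variable {R : Type*} [CommRing R] {d n : ℕ} {i j : Fin d ↪o Fin n} {w : Equiv.Perm (Fin d)}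

/-- Row `k` is supported on the interval from `i_k` to `j_{w⁻¹ k}`, with units at both ends. -/
structure IsIntervalMatrix (i j : Fin d ↪o Fin n) (w : Equiv.Perm (Fin d))
    (Z : Matrix (Fin d) (Fin n) R) : Prop where
  left : ∀ k l, l < i k → Z k l = 0
  right : ∀ k l, j (w⁻¹ k) < l → Z k l = 0
  isUnit_left : ∀ k, IsUnit (Z k (i k))
  isUnit_right : ∀ k, IsUnit (Z k (j (w⁻¹ k)))

/-- Interval matrices with entries `1` at the left ends and `0` above the marked points. -/
structure IsNormalForm (i j : Fin d ↪o Fin n) (w : Equiv.Perm (Fin d))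
    (Z : Matrix (Fin d) (Fin n) R) : Prop extends IsIntervalMatrix i j w Z where
  one_left : ∀ k, Z k (i k) = 1
  reduced : ∀ k k', k < k' → Z k (j (w⁻¹ k')) = 0

namespace IsIntervalMatrix

variable {Z : Matrix (Fin d) (Fin n) R}

theorem upper (hZ : IsIntervalMatrix i j w Z) :
    ∀ a b, b < a → Z.submatrix id i a b = 0 :=
  fun a _ h => hZ.left a _ (i.lt_iff_lt.2 h)

theorem isUnit_det (hZ : IsIntervalMatrix i j w Z) : IsUnit (Z.submatrix id i).det :=
  isUnit_det_of_upper hZ.upper hZ.isUnit_left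

theorem lower (hZ : IsIntervalMatrix i j w Z) :
    ∀ a b, a < b → Z.submatrix w j a b = 0 :=
  fun a _ h => hZ.right (w a) _ (by simpa using h)

theorem isUnit_det_right (hZ : IsIntervalMatrix i j w Z) : IsUnit (Z.submatrix w j).det :=
  isUnit_det_of_lower hZ.lower fun a => by simpa using hZ.isUnit_right (w a)

/-- Put row `a` of `Z` into column `i a` of the identity matrix: the left bounds of the rows make
the result lower triangular, and the units at the left ends make it invertible. -/
theorem rowSpan_mem_bruhatNeg (hZ : IsIntervalMatrix i j w Z) :
    (⟨rowSpan Z, rowSpan_mem_grassmannian Z i hZ.isUnit_det⟩ : Grassmannian R d n) ∈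
      bruhatNeg R i := by
  classical
  let G : Matrix (Fin n) (Fin n) R := Matrix.of fun m l =>
    if h : ∃ a, i a = l then Z h.choose m else if m = l then 1 else 0
  have hG : ∀ a m, G m (i a) = Z a m := by
    intro a m
    have h : ∃ b, i b = i a := ⟨a, rfl⟩
    have : h.choose = a := i.injective h.choose_spec
    simp only [G, Matrix.of_apply, dif_pos h, this]
  have hG' : ∀ l, (¬ ∃ a, i a = l) → ∀ m, G m l = if m = l then 1 else 0 := by
    intro l h m
    simp only [G, Matrix.of_apply, dif_neg h]
  have hlow : ∀ m l, m < l → G m l = 0 := by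
    intro m l hml
    by_cases h : ∃ a, i a = l
    · obtain ⟨a, rfl⟩ := h
      rw [hG, hZ.left _ _ hml]
    · rw [hG' l h, if_neg hml.ne]
  have hdiag : ∀ l, IsUnit (G l l) := by
    intro l
    by_cases h : ∃ a, i a = l
    · obtain ⟨a, rfl⟩ := h
      rw [hG]
      exact hZ.isUnit_left a
    · rw [hG' l h, if_pos rfl]
      exact isUnit_one
  refine ⟨Matrix.nonsingInvUnit G (isUnit_det_of_lower hlow hdiag), hlow, ?_⟩
  rw [glAct_rowSpan]
  change rowSpan Z = rowSpan (eMatrix R i * G.transpose)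
  congr 1
  ext a l
  rw [eMatrix_mul_transpose_apply, hG]

/-- Mirror image of the previous argument: row `w a` ends at `j a`, so the rows have to be reordered
by `w` first. -/
theorem rowSpan_mem_bruhatPos (hZ : IsIntervalMatrix i j w Z) :
    (⟨rowSpan Z, rowSpan_mem_grassmannian Z i hZ.isUnit_det⟩ : Grassmannian R d n) ∈
      bruhatPos R j := by
  classical
  let G : Matrix (Fin n) (Fin n) R := Matrix.of fun m l =>
    if h : ∃ a, j a = l then Z (w h.choose) m else if m = l then 1 else 0
  have hG : ∀ a m, G m (j a) = Z (w a) m := by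
    intro a m
    have h : ∃ b, j b = j a := ⟨a, rfl⟩
    have : h.choose = a := j.injective h.choose_spec
    simp only [G, Matrix.of_apply, dif_pos h, this]
  have hG' : ∀ l, (¬ ∃ a, j a = l) → ∀ m, G m l = if m = l then 1 else 0 := by
    intro l h m
    simp only [G, Matrix.of_apply, dif_neg h]
  have hup : ∀ m l, l < m → G m l = 0 := by
    intro m l hml
    by_cases h : ∃ a, j a = l
    · obtain ⟨a, rfl⟩ := h
      rw [hG, hZ.right _ _ (by simpa using hml)]
    · rw [hG' l h, if_neg hml.ne']
  have hdiag : ∀ l, IsUnit (G l l) := by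
    intro l
    by_cases h : ∃ a, j a = l
    · obtain ⟨a, rfl⟩ := h
      rw [hG]
      simpa using hZ.isUnit_right (w a)
    · rw [hG' l h, if_pos rfl]
      exact isUnit_one
  refine ⟨Matrix.nonsingInvUnit G (isUnit_det_of_upper hup hdiag), hup, ?_⟩
  rw [glAct_rowSpan]
  change rowSpan Z = rowSpan (eMatrix R j * G.transpose)
  rw [← rowSpan_submatrix_equiv Z w]
  congr 1
  ext a l
  rw [eMatrix_mul_transpose_apply, hG]
  rfl

/-- `Z` itself is a witness: `Z_I` is upper triangular, and `Z_J` is the permutation matrix of `w`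
times a lower triangular matrix. -/
theorem rowSpan_mem_gaussStratum (hZ : IsIntervalMatrix i j w Z) :
    (⟨rowSpan Z, rowSpan_mem_grassmannian Z i hZ.isUnit_det⟩ : Grassmannian R d n) ∈
      gaussStratum R i j w := by
  refine ⟨⟨hZ.rowSpan_mem_bruhatNeg, hZ.rowSpan_mem_bruhatPos⟩, Z, rfl, ?_⟩
  refine ⟨(Matrix.nonsingInvUnit _ hZ.isUnit_det)⁻¹, Matrix.nonsingInvUnit _ hZ.isUnit_det_right,
    ?_, hZ.lower, ?_⟩
  · intro a b hab
    rw [Matrix.coe_units_inv]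
    exact inv_upper hZ.upper hZ.isUnit_det a b hab
  · rw [Matrix.coe_units_inv, baseChangeMatrix, Matrix.mul_assoc]
    congr 1
    ext a b
    change _ = (permMat R w * Z.submatrix w j) a b
    rw [permMat_mul_apply]
    simp

end IsIntervalMatrix

theorem exists_isIntervalMatrix {W : Grassmannian R d n} (hW : W ∈ gaussStratum R i j w) :
    ∃ Z : Matrix (Fin d) (Fin n) R, IsIntervalMatrix i j w Z ∧ rowSpan Z = W.1 := by
  obtain ⟨⟨⟨g, hg, hWg⟩, ⟨g', hg', hWg'⟩⟩, X, hX, b, c, hb, hc, hA⟩ := hW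
  rw [glAct_rowSpan] at hWg hWg'
  set X₁ := eMatrix R i * (g : Matrix (Fin n) (Fin n) R).transpose with hX₁
  set X₂ := eMatrix R j * (g' : Matrix (Fin n) (Fin n) R).transpose with hX₂
  have e₁ : ∀ a l, X₁ a l = (g : Matrix (Fin n) (Fin n) R) l (i a) :=
    eMatrix_mul_transpose_apply i _
  have e₂ : ∀ a l, X₂ a l = (g' : Matrix (Fin n) (Fin n) R) l (j a) :=
    eMatrix_mul_transpose_apply j _
  have u₁ : ∀ a, IsUnit (X₁ a (i a)) := fun a => by
    rw [e₁]; exact isUnit_diag_of_lower hg (isUnit_det_coe g) _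
  have u₂ : ∀ a, IsUnit (X₂ a (j a)) := fun a => by
    rw [e₂]; exact isUnit_diag_of_upper hg' (isUnit_det_coe g') _
  have z₁ : ∀ a l, l < i a → X₁ a l = 0 := fun a l h => by rw [e₁]; exact hg _ _ h
  have z₂ : ∀ a l, j a < l → X₂ a l = 0 := fun a l h => by rw [e₂]; exact hg' _ _ h
  have up₁ : ∀ a b, b < a → X₁.submatrix id i a b = 0 := fun a b h => z₁ a _ (i.lt_iff_lt.2 h)
  have lo₂ : ∀ a b, a < b → X₂.submatrix id j a b = 0 := fun a b h => z₂ a _ (j.lt_iff_lt.2 h)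
  have d₁ : IsUnit (X₁.submatrix id i).det := isUnit_det_of_upper up₁ u₁
  have d₂ : IsUnit (X₂.submatrix id j).det := isUnit_det_of_lower lo₂ u₂
  obtain ⟨h₁, hh₁⟩ := rowSpan_le_iff.1 (hX.trans hWg).le
  obtain ⟨h₁', hh₁'⟩ := rowSpan_le_iff.1 (hX.trans hWg).ge
  obtain ⟨h₂, hh₂⟩ := rowSpan_le_iff.1 (hX.trans hWg').le
  have dX : IsUnit (X.submatrix id i).det := by
    have := d₁
    rw [hh₁', submatrix_cols_mul, Matrix.det_mul] at this
    exact isUnit_of_mul_isUnit_right this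
  have dh₁ : IsUnit h₁.det := by
    have := dX
    rw [hh₁, submatrix_cols_mul, Matrix.det_mul] at this
    exact isUnit_of_mul_isUnit_left this
  have eq₁ : (X.submatrix id i)⁻¹ * X = (X₁.submatrix id i)⁻¹ * X₁ := by
    conv_lhs => rw [hh₁, submatrix_cols_mul, Matrix.mul_inv_rev, Matrix.mul_assoc,
      ← Matrix.mul_assoc h₁⁻¹, Matrix.nonsing_inv_mul _ dh₁, Matrix.one_mul]
  -- `X_I⁻¹ X = (X_I⁻¹ X_J) X_J⁻¹ X`, where the first factor is `b w c` and `X_J⁻¹ X` may be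
  -- computed from `X₂`.
  have eq₂ : (X.submatrix id i)⁻¹ * X =
      (b : Matrix (Fin d) (Fin d) R) * (permMat R w *
        ((c : Matrix (Fin d) (Fin d) R) * (X₂.submatrix id j)⁻¹ * X₂)) := by
    have : (X.submatrix id i)⁻¹ * h₂ = b * permMat R w * c * (X₂.submatrix id j)⁻¹ := by
      rw [← hA, baseChangeMatrix, hh₂, submatrix_cols_mul h₂ X₂ j, ← hh₂]
      simp only [Matrix.mul_assoc]
      rw [Matrix.mul_nonsing_inv _ d₂, Matrix.mul_one]
    conv_lhs => rw [hh₂, ← Matrix.mul_assoc, ← hh₂, this]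
    simp only [Matrix.mul_assoc]
  have db := isUnit_det_coe b
  set U := (b : Matrix (Fin d) (Fin d) R)⁻¹ * (X₁.submatrix id i)⁻¹ with hU
  set V := (c : Matrix (Fin d) (Fin d) R) * (X₂.submatrix id j)⁻¹ with hV
  have dU : IsUnit U.det := by
    rw [hU, Matrix.det_mul]
    exact (Matrix.isUnit_nonsing_inv_det _ db).mul (Matrix.isUnit_nonsing_inv_det _ d₁)
  have dV : IsUnit V.det := by
    rw [hV, Matrix.det_mul]
    exact (isUnit_det_coe c).mul (Matrix.isUnit_nonsing_inv_det _ d₂)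
  have hUup : ∀ a b, b < a → U a b = 0 := mul_upper (inv_upper hb db) (inv_upper up₁ d₁)
  have hVlo : ∀ a b, a < b → V a b = 0 := mul_lower hc (inv_lower lo₂ d₂)
  have hUV : U * X₁ = permMat R w * (V * X₂) := by
    rw [hU, Matrix.mul_assoc, ← eq₁, eq₂, ← Matrix.mul_assoc, Matrix.nonsing_inv_mul _ db,
      Matrix.one_mul]
  -- Up to column `i k`, only the diagonal entry of `U` contributes: earlier rows have coefficient
  -- `0`, later rows have not started.
  have hl : ∀ k l, l ≤ i k → (U * X₁) k l = U k k * X₁ k l := by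
    intro k l h
    refine mul_apply_eq_of_forall_ne fun b hb => ?_
    rcases lt_or_gt_of_ne hb with h' | h'
    · exact Or.inl (hUup _ _ h')
    · exact Or.inr (z₁ _ _ (h.trans_lt (i.lt_iff_lt.2 h')))
  have hr : ∀ k l, j k ≤ l → (V * X₂) k l = V k k * X₂ k l := by
    intro k l h
    refine mul_apply_eq_of_forall_ne fun b hb => ?_
    rcases lt_or_gt_of_ne hb with h' | h'
    · exact Or.inr (z₂ _ _ ((j.lt_iff_lt.2 h').trans_le h))
    · exact Or.inl (hVlo _ _ h')
  refine ⟨U * X₁, ⟨?_, ?_, ?_, ?_⟩, (rowSpan_mul_of_isUnit dU X₁).trans hWg.symm⟩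
  · intro k l h
    rw [hl k l h.le, z₁ k l h, mul_zero]
  · intro k l h
    rw [hUV, permMat_mul_apply, hr _ l h.le, z₂ _ l h, mul_zero]
  · intro k
    rw [hl k _ le_rfl]
    exact (isUnit_diag_of_upper hUup dU k).mul (u₁ k)
  · intro k
    rw [hUV, permMat_mul_apply, hr _ _ le_rfl]
    exact (isUnit_diag_of_lower hVlo dV _).mul (u₂ _)

end Interval

/-! ### Existence and uniqueness of normal forms -/

section NormalForm

variable {R : Type*} [CommRing R] {d n : ℕ} {i j : Fin d ↪o Fin n} {w : Equiv.Perm (Fin d)}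

namespace IsIntervalMatrix

/-- The column of the marked point in row `m` can be cleared above that point, without affecting
the columns of the marked points in later rows. -/
theorem exists_clear_column {Z : Matrix (Fin d) (Fin n) R} (hZ : IsIntervalMatrix i j w Z)
    (m : Fin d) (hred : ∀ k k', k < k' → m < k' → Z k (j (w⁻¹ k')) = 0) :
    ∃ Z' : Matrix (Fin d) (Fin n) R, IsIntervalMatrix i j w Z' ∧ rowSpan Z' = rowSpan Z ∧
      ∀ k k', k < k' → m ≤ k' → Z' k (j (w⁻¹ k')) = 0 := by
  obtain ⟨u, hu⟩ := hZ.isUnit_right m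
  -- The multiples of row `m` to subtract from the rows above it.
  let c : Fin d → R := fun a => if a < m then Z a (j (w⁻¹ m)) * (u⁻¹ : Rˣ) else 0
  let E : Matrix (Fin d) (Fin d) R := 1 - Matrix.vecMulVec c (Pi.single m 1)
  have hE : ∀ a l, (E * Z) a l = Z a l - c a * Z m l := by
    intro a l
    simp only [E, Matrix.sub_mul, Matrix.one_mul, Matrix.sub_apply, Matrix.vecMulVec_mul,
      Matrix.single_one_vecMul, Matrix.vecMulVec_apply, Matrix.row]
  -- If row `a` ends before the marked column of row `m`, its coefficient is `0`. Otherwise the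
  -- interval of row `m` lies strictly inside that of row `a`, so both ends of row `a` are
  -- untouched.
  have hc : ∀ a l, (l ≤ i a ∨ j (w⁻¹ a) ≤ l) → c a * Z m l = 0 := by
    intro a l hl
    by_cases ham : a < m
    · rcases lt_trichotomy (j (w⁻¹ a)) (j (w⁻¹ m)) with h | h | h
      · simp only [c, if_pos ham, hZ.right a _ h, zero_mul]
      · exact absurd (w⁻¹.injective (j.injective h)) ham.ne
      · rcases hl with hl | hl
        · rw [hZ.left m l (hl.trans_lt (i.lt_iff_lt.2 ham)), mul_zero]
        · rw [hZ.right m l (h.trans_le hl), mul_zero]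
    · simp only [c, if_neg ham, zero_mul]
  have hcm : ∀ a, m ≤ a → c a = 0 := fun a ha => if_neg ha.not_gt
  have hEdet : IsUnit E.det := by
    refine isUnit_det_of_upper (fun a b hab => ?_) fun a => ?_
    · by_cases hbm : b = m
      · subst hbm
        simp [E, Matrix.vecMulVec_apply, hcm a hab.le, hab.ne']
      · simp [E, Matrix.vecMulVec_apply, hab.ne', hbm]
    · by_cases ham : a = m
      · subst ham
        simp [E, Matrix.vecMulVec_apply, hcm a le_rfl]
      · simp [E, Matrix.vecMulVec_apply, ham]
  refine ⟨E * Z, ⟨?_, ?_, ?_, ?_⟩, rowSpan_mul_of_isUnit hEdet Z, ?_⟩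
  · intro k l h
    rw [hE, hZ.left k l h, hc k l (Or.inl h.le), sub_zero]
  · intro k l h
    rw [hE, hZ.right k l h, hc k l (Or.inr h.le), sub_zero]
  · intro k
    rw [hE, hc k _ (Or.inl le_rfl), sub_zero]
    exact hZ.isUnit_left k
  · intro k
    rw [hE, hc k _ (Or.inr le_rfl), sub_zero]
    exact hZ.isUnit_right k
  · intro k k' hk hm
    rw [hE]
    rcases hm.eq_or_lt with rfl | hm
    · simp only [c, if_pos hk, ← hu, mul_assoc, Units.inv_mul, mul_one, sub_self]
    · rw [hred k k' hk hm, hred m k' hm hm, mul_zero, sub_zero]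

/-- The columns are cleared from the last row upwards, since clearing for row `m` spoils only
columns belonging to earlier rows; `t` counts the rows done. -/
theorem exists_reduced_from {Z : Matrix (Fin d) (Fin n) R} (hZ : IsIntervalMatrix i j w Z)
    (t : ℕ) : ∃ Z' : Matrix (Fin d) (Fin n) R, IsIntervalMatrix i j w Z' ∧
      rowSpan Z' = rowSpan Z ∧
      ∀ k k' : Fin d, k < k' → d ≤ (k' : ℕ) + t → Z' k (j (w⁻¹ k')) = 0 := by
  induction t with
  | zero => exact ⟨Z, hZ, rfl, fun k k' _ h => by omega⟩
  | succ t ih =>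
    obtain ⟨Y, hY, hYZ, hred⟩ := ih
    by_cases ht : t < d
    · obtain ⟨Y', hY', hYY', hred'⟩ := hY.exists_clear_column ⟨d - (t + 1), by omega⟩
        (fun k k' hk hm => hred k k' hk (by rw [Fin.lt_def] at hm; simp at hm; omega))
      exact ⟨Y', hY', hYY'.trans hYZ, fun k k' hk h => hred' k k' hk
        (by rw [Fin.le_def]; simp; omega)⟩
    · exact ⟨Y, hY, hYZ, fun k k' hk _ => hred k k' hk (by omega)⟩

theorem exists_isNormalForm {Z : Matrix (Fin d) (Fin n) R} (hZ : IsIntervalMatrix i j w Z) :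
    ∃ Z' : Matrix (Fin d) (Fin n) R, IsNormalForm i j w Z' ∧ rowSpan Z' = rowSpan Z := by
  obtain ⟨Y, hY, hYZ, hred⟩ := hZ.exists_reduced_from d
  choose u hu using hY.isUnit_left
  have hD : ∀ k l, (Matrix.diagonal (fun k => ((u k)⁻¹ : Rˣ) : Fin d → R) * Y) k l =
      ((u k)⁻¹ : Rˣ) * Y k l := fun k l => Matrix.diagonal_mul _ _ _ _
  have hdet : IsUnit (Matrix.diagonal (fun k => ((u k)⁻¹ : Rˣ) : Fin d → R)).det := by
    rw [Matrix.det_diagonal]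
    exact IsUnit.prod_univ_iff.2 fun k => Units.isUnit _
  refine ⟨_, ⟨⟨?_, ?_, ?_, ?_⟩, ?_, ?_⟩, (rowSpan_mul_of_isUnit hdet Y).trans hYZ⟩
  · intro k l h
    rw [hD, hY.left k l h, mul_zero]
  · intro k l h
    rw [hD, hY.right k l h, mul_zero]
  · intro k
    rw [hD]
    exact (Units.isUnit _).mul (hY.isUnit_left k)
  · intro k
    rw [hD]
    exact (Units.isUnit _).mul (hY.isUnit_right k)
  · intro k
    rw [hD, ← hu, Units.inv_mul]
  · intro k k' hk
    rw [hD, hred k k' hk (by omega), mul_zero]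

end IsIntervalMatrix

/-- The columns whose minors recover row `k` of a normal form. -/
def minorCols (i j : Fin d ↪o Fin n) (w : Equiv.Perm (Fin d)) (k : Fin d) : Fin d → Fin n :=
  fun b => if b ≤ k then i b else j (w⁻¹ b)

/-- The maximal minor on the columns `minorCols i j w k`. -/
def denominatorMinor (i j : Fin d ↪o Fin n) (w : Equiv.Perm (Fin d))
    (X : Matrix (Fin d) (Fin n) R) (k : Fin d) : R :=
  (X.submatrix id (minorCols i j w k)).det

/-- The maximal minor on the columns `minorCols i j w k`, with the `k`-th one replaced by `l`. -/
def numeratorMinor (i j : Fin d ↪o Fin n) (w : Equiv.Perm (Fin d))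
    (X : Matrix (Fin d) (Fin n) R) (k : Fin d) (l : Fin n) : R :=
  (X.submatrix id (Function.update (minorCols i j w k) k l)).det

theorem denominatorMinor_mul (h : Matrix (Fin d) (Fin d) R) (X : Matrix (Fin d) (Fin n) R)
    (k : Fin d) : denominatorMinor i j w (h * X) k = h.det * denominatorMinor i j w X k := by
  rw [denominatorMinor, submatrix_cols_mul, Matrix.det_mul, denominatorMinor]

theorem numeratorMinor_mul (h : Matrix (Fin d) (Fin d) R) (X : Matrix (Fin d) (Fin n) R)
    (k : Fin d) (l : Fin n) :
    numeratorMinor i j w (h * X) k l = h.det * numeratorMinor i j w X k l := by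
  rw [numeratorMinor, submatrix_cols_mul, Matrix.det_mul, numeratorMinor]

namespace IsNormalForm

variable {Z : Matrix (Fin d) (Fin n) R}

/-- The columns with `b < k` lie left of the interval of row `k`, and those with `b > k` have been
cleared in it. -/
theorem minorCols_row (hZ : IsNormalForm i j w Z) (k : Fin d) :
    Z.submatrix id (minorCols i j w k) k = Pi.single k 1 := by
  ext b
  rw [Matrix.submatrix_apply, id, minorCols]
  rcases lt_trichotomy b k with h | rfl | h
  · rw [if_pos h.le, hZ.left _ _ (i.lt_iff_lt.2 h), Pi.single_eq_of_ne h.ne]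
  · rw [if_pos le_rfl, hZ.one_left, Pi.single_eq_same]
  · rw [if_neg h.not_ge, hZ.reduced _ _ h, Pi.single_eq_of_ne h.ne']

theorem isUnit_denominatorMinor (hZ : IsNormalForm i j w Z) (k : Fin d) :
    IsUnit (denominatorMinor i j w Z k) := by
  -- Indices up to `k` keep their order; the later ones come after them, reversed. The columns `i b`
  -- vanish below row `b` and the columns `j (w⁻¹ b)` above it, so the minor is triangular in this
  -- order.
  let σ : Fin d → ℕ := fun b => if b ≤ k then b else 2 * d - b
  have hσ : Function.Injective σ := by
    intro a b hab
    simp only [σ] at hab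
    apply Fin.ext
    split_ifs at hab <;> omega
  rw [denominatorMinor, det_of_blockTriangular_injective hσ]
  · refine IsUnit.prod_univ_iff.2 fun a => ?_
    rw [Matrix.submatrix_apply, id, minorCols]
    split_ifs
    · exact hZ.isUnit_left a
    · exact hZ.isUnit_right a
  · intro a b hab
    rw [Matrix.submatrix_apply, id, minorCols]
    simp only [σ, Fin.le_def] at hab
    split_ifs with hb
    · refine hZ.left _ _ (i.lt_iff_lt.2 ?_)
      rw [Fin.le_def] at hb
      rw [Fin.lt_def]
      split_ifs at hab <;> omega
    · refine hZ.reduced _ _ ?_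
      rw [Fin.le_def] at hb
      rw [Fin.lt_def]
      split_ifs at hab <;> omega

theorem numeratorMinor_eq (hZ : IsNormalForm i j w Z) (k : Fin d) (l : Fin n) :
    numeratorMinor i j w Z k l = Z k l * denominatorMinor i j w Z k := by
  set M := Z.submatrix id (minorCols i j w k) with hM
  have hcol : Z.submatrix id (Function.update (minorCols i j w k) k l) =
      M.updateCol k fun a => Z a l := by
    ext a b
    by_cases hb : b = k
    · subst hb
      simp
    · simp [hM, hb]
  -- Row `k` of `M` is a standard basis vector, so row `k` of `M * M.adjugate = det M` reads off row
  -- `k` of the adjugate. Only one term of Cramer's rule survives.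
  have hadj : M.adjugate k = Pi.single k M.det := by
    have h1 : Matrix.vecMul (M k) M.adjugate = (M * M.adjugate) k :=
      (Matrix.mul_apply_eq_vecMul _ _ _).symm
    rw [hM, hZ.minorCols_row k, ← hM, Matrix.single_one_vecMul, Matrix.mul_adjugate] at h1
    ext b
    change M.adjugate.row k b = _
    rw [h1]
    simp [Matrix.one_apply, Pi.single_apply, eq_comm]
  rw [numeratorMinor, hcol, ← Matrix.cramer_apply, Matrix.cramer_eq_adjugate_mulVec, Matrix.mulVec,
    hadj, single_dotProduct, mul_comm]
  rfl

/-- The entries of a normal form are quotients of minors of any matrix with the same row span. -/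
theorem apply_mul_denominatorMinor (hZ : IsNormalForm i j w Z) {X : Matrix (Fin d) (Fin n) R}
    (hX : rowSpan X = rowSpan Z) (k : Fin d) (l : Fin n) :
    IsUnit (denominatorMinor i j w X k) ∧
      Z k l * denominatorMinor i j w X k = numeratorMinor i j w X k l := by
  obtain ⟨h, hh⟩ := rowSpan_le_iff.1 hX.ge
  have h1 := hZ.isUnit_denominatorMinor k
  have h2 := hZ.numeratorMinor_eq k l
  rw [hh, denominatorMinor_mul] at h1
  rw [hh, denominatorMinor_mul, numeratorMinor_mul, ← hh] at h2
  have hu := isUnit_of_mul_isUnit_left h1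
  refine ⟨isUnit_of_mul_isUnit_right h1, hu.mul_left_cancel ?_⟩
  rw [h2]
  ring

theorem eq_of_rowSpan_eq (hZ : IsNormalForm i j w Z) {Z' : Matrix (Fin d) (Fin n) R}
    (hZ' : IsNormalForm i j w Z') (h : rowSpan Z = rowSpan Z') : Z = Z' := by
  ext k l
  have h1 := hZ.apply_mul_denominatorMinor rfl k l
  have h2 := hZ'.apply_mul_denominatorMinor h k l
  exact h1.1.mul_right_cancel (h1.2.trans h2.2.symm)

end IsNormalForm

end NormalForm

/-! ### Coordinates on normal forms -/

section Coordinates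

variable {R : Type*} [CommRing R] {d n : ℕ} {i j : Fin d ↪o Fin n} {w : Equiv.Perm (Fin d)}

theorem mem_markedPoints {k : Fin d} {l : Fin n} :
    (k, l) ∈ markedPoints j w ↔ l = j (w⁻¹ k) := by
  simp only [markedPoints, Finset.mem_image, Finset.mem_univ, true_and, Prod.mk.injEq]
  constructor
  · rintro ⟨a, rfl, rfl⟩
    simp
  · rintro rfl
    exact ⟨w⁻¹ k, by simp, rfl⟩

theorem mem_gmNodes {k : Fin d} {l : Fin n} :
    (k, l) ∈ gmNodes i j w ↔ l = j (w⁻¹ k) ∧ i k ≠ j (w⁻¹ k) := by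
  rw [gmNodes, Finset.mem_filter, mem_markedPoints]

theorem mem_a1Nodes {k : Fin d} {l : Fin n} :
    (k, l) ∈ a1Nodes i j w ↔
      (i k < l ∧ l < j (w⁻¹ k)) ∧ ∀ k', k < k' → l ≠ j (w⁻¹ k') := by
  rw [a1Nodes, Finset.mem_filter]
  simp only [Finset.mem_univ, true_and, mem_markedPoints, not_exists, not_and]

theorem le_of_mem_monotonePerms (hw : w ∈ monotonePerms i j) (k : Fin d) :
    i k ≤ j (w⁻¹ k) := by
  simpa using hw (w⁻¹ k)

theorem notMem_a1Nodes_of_mem_gmNodes {p : Fin d × Fin n} (hp : p ∈ gmNodes i j w) :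
    p ∉ a1Nodes i j w := fun h => (mem_a1Nodes.1 h).1.2.ne (mem_gmNodes.1 hp).1

/-- The positions of the nodes of the Fukaya diagram, the `𝔾ₘ`-nodes first. -/
noncomputable def nodePos (i j : Fin d ↪o Fin n) (w : Equiv.Perm (Fin d)) :
    Fin (gmNodes i j w).card ⊕ Fin (a1Nodes i j w).card → Fin d × Fin n :=
  Sum.elim (fun a => ((gmNodes i j w).equivFin.symm a).1)
    (fun b => ((a1Nodes i j w).equivFin.symm b).1)

/-- The matrix with the given entries at the nodes, entries `1` at the left ends
`(k, i_k)`, and `0` elsewhere. -/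
noncomputable def ofCoords (i j : Fin d ↪o Fin n) (w : Equiv.Perm (Fin d))
    (x : Fin (gmNodes i j w).card ⊕ Fin (a1Nodes i j w).card → R) :
    Matrix (Fin d) (Fin n) R :=
  Matrix.of fun k l =>
    if h : (k, l) ∈ gmNodes i j w then x (Sum.inl ((gmNodes i j w).equivFin ⟨_, h⟩))
    else if h : (k, l) ∈ a1Nodes i j w then x (Sum.inr ((a1Nodes i j w).equivFin ⟨_, h⟩))
    else if l = i k then 1 else 0

section OfCoords

variable {x : Fin (gmNodes i j w).card ⊕ Fin (a1Nodes i j w).card → R}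

theorem ofCoords_of_mem_gmNodes {k : Fin d} {l : Fin n} (h : (k, l) ∈ gmNodes i j w) :
    ofCoords i j w x k l = x (Sum.inl ((gmNodes i j w).equivFin ⟨_, h⟩)) := by
  rw [ofCoords, Matrix.of_apply, dif_pos h]

theorem ofCoords_of_mem_a1Nodes {k : Fin d} {l : Fin n} (h : (k, l) ∈ a1Nodes i j w) :
    ofCoords i j w x k l = x (Sum.inr ((a1Nodes i j w).equivFin ⟨_, h⟩)) := by
  rw [ofCoords, Matrix.of_apply, dif_neg fun h' => notMem_a1Nodes_of_mem_gmNodes h' h, dif_pos h]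

theorem ofCoords_of_notMem {k : Fin d} {l : Fin n} (h : (k, l) ∉ gmNodes i j w)
    (h' : (k, l) ∉ a1Nodes i j w) : ofCoords i j w x k l = if l = i k then 1 else 0 := by
  rw [ofCoords, Matrix.of_apply, dif_neg h, dif_neg h']

theorem ofCoords_nodePos (c : Fin (gmNodes i j w).card ⊕ Fin (a1Nodes i j w).card) :
    ofCoords i j w x (nodePos i j w c).1 (nodePos i j w c).2 = x c := by
  rcases c with a | b
  · exact (ofCoords_of_mem_gmNodes ((gmNodes i j w).equivFin.symm a).2).trans
      (congrArg (fun t => x (Sum.inl t)) ((gmNodes i j w).equivFin.apply_symm_apply a))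
  · exact (ofCoords_of_mem_a1Nodes ((a1Nodes i j w).equivFin.symm b).2).trans
      (congrArg (fun t => x (Sum.inr t)) ((a1Nodes i j w).equivFin.apply_symm_apply b))

/-- Behind both naturality and the polynomial description: every entry is a coordinate, `0` or `1`.
-/
theorem ofCoords_map {R' : Type*} [CommRing R'] (f : R →+* R') :
    (ofCoords i j w x).map f = ofCoords i j w (f ∘ x) := by
  ext k l
  simp only [Matrix.map_apply, ofCoords, Matrix.of_apply]
  split_ifs <;> simp

theorem isNormalForm_ofCoords (hw : w ∈ monotonePerms i j)
    (hx : x ∈ gmTimesA R (gmNodes i j w).card (a1Nodes i j w).card) :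
    IsNormalForm i j w (ofCoords i j w x) := by
  have hle := le_of_mem_monotonePerms hw
  have hone : ∀ k, ofCoords i j w x k (i k) = 1 := by
    intro k
    rw [ofCoords_of_notMem, if_pos rfl]
    · exact fun h => (mem_gmNodes.1 h).2 (mem_gmNodes.1 h).1
    · exact fun h => (mem_a1Nodes.1 h).1.1.false
  refine ⟨⟨?_, ?_, ?_, ?_⟩, hone, ?_⟩
  · intro k l h
    rw [ofCoords_of_notMem, if_neg h.ne]
    · exact fun h' => (h.trans_le (hle k)).ne (mem_gmNodes.1 h').1
    · exact fun h' => h.asymm (mem_a1Nodes.1 h').1.1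
  · intro k l h
    rw [ofCoords_of_notMem, if_neg ((hle k).trans_lt h).ne']
    · exact fun h' => h.ne' (mem_gmNodes.1 h').1
    · exact fun h' => h.asymm (mem_a1Nodes.1 h').1.2
  · intro k
    rw [hone]
    exact isUnit_one
  · intro k
    -- When both ends coincide, the marked point is no node and its entry is the normalized `1`.
    by_cases h : i k = j (w⁻¹ k)
    · rw [← h, hone]
      exact isUnit_one
    · rw [ofCoords_of_mem_gmNodes (mem_gmNodes.2 ⟨rfl, h⟩)]
      exact hx _
  · intro k k' hk
    rw [ofCoords_of_notMem, if_neg ((i.lt_iff_lt.2 hk).trans_le (hle k')).ne']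
    · exact fun h => hk.ne' (w⁻¹.injective (j.injective (mem_gmNodes.1 h).1))
    · exact fun h => (mem_a1Nodes.1 h).2 k' hk rfl

end OfCoords

theorem IsNormalForm.coords_mem {Z : Matrix (Fin d) (Fin n) R} (hZ : IsNormalForm i j w Z) :
    (fun c => Z (nodePos i j w c).1 (nodePos i j w c).2) ∈
      gmTimesA R (gmNodes i j w).card (a1Nodes i j w).card := by
  intro a
  have h := mem_gmNodes.1 ((gmNodes i j w).equivFin.symm a).2
  change IsUnit (Z ((gmNodes i j w).equivFin.symm a).1.1 ((gmNodes i j w).equivFin.symm a).1.2)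
  rw [h.1]
  exact hZ.isUnit_right _

/-- Off the nodes, each of the conditions on a normal form forces a value, and together they cover
all positions. -/
theorem IsNormalForm.ofCoords_coords {Z : Matrix (Fin d) (Fin n) R}
    (hZ : IsNormalForm i j w Z) :
    ofCoords i j w (fun c => Z (nodePos i j w c).1 (nodePos i j w c).2) = Z := by
  ext k l
  by_cases h : (k, l) ∈ gmNodes i j w
  · rw [ofCoords_of_mem_gmNodes h]
    simp [nodePos]
  by_cases h' : (k, l) ∈ a1Nodes i j w
  · rw [ofCoords_of_mem_a1Nodes h']
    simp [nodePos]
  rw [ofCoords_of_notMem h h']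
  split_ifs with hl
  · rw [hl, hZ.one_left]
  · rw [mem_gmNodes] at h
    rw [mem_a1Nodes] at h'
    rcases lt_or_gt_of_ne hl with h1 | h1
    · exact (hZ.left k l h1).symm
    rcases lt_trichotomy l (j (w⁻¹ k)) with h2 | h2 | h2
    · push Not at h'
      obtain ⟨k', hk, rfl⟩ := h' ⟨h1, h2⟩
      exact (hZ.reduced k k' hk).symm
    · push Not at h
      exact absurd (h2.trans (h h2).symm) hl
    · exact (hZ.right k l h2).symm

/-- The point of the stratum with the given coordinates. -/
noncomputable def stratumOfCoords (R : Type*) [CommRing R] (hw : w ∈ monotonePerms i j)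
    (x : gmTimesA R (gmNodes i j w).card (a1Nodes i j w).card) : gaussStratum R i j w :=
  ⟨_, (isNormalForm_ofCoords hw x.2).rowSpan_mem_gaussStratum⟩

theorem stratumOfCoords_bijective (R : Type*) [CommRing R] (hw : w ∈ monotonePerms i j) :
    Function.Bijective (stratumOfCoords R hw) := by
  constructor
  · intro x y hxy
    have h : rowSpan (ofCoords i j w x.1) = rowSpan (ofCoords i j w y.1) :=
      congrArg (fun W : gaussStratum R i j w => W.1.1) hxy
    have h' := (isNormalForm_ofCoords hw x.2).eq_of_rowSpan_eq (isNormalForm_ofCoords hw y.2) h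
    apply Subtype.ext
    ext c
    rw [← ofCoords_nodePos (x := x.1) c, h', ofCoords_nodePos]
  · rintro ⟨W, hW⟩
    obtain ⟨Z₀, hZ₀, hW₀⟩ := exists_isIntervalMatrix hW
    obtain ⟨Z, hZ, hZZ₀⟩ := hZ₀.exists_isNormalForm
    refine ⟨⟨_, hZ.coords_mem⟩, Subtype.ext (Subtype.ext ?_)⟩
    change rowSpan (ofCoords i j w _) = W.1
    rw [hZ.ofCoords_coords, hZZ₀, hW₀]

/-- The coordinates on the Gauss-type stratum. -/
noncomputable def stratumEquiv (R : Type*) [CommRing R] (hw : w ∈ monotonePerms i j) :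
    gaussStratum R i j w ≃ gmTimesA R (gmNodes i j w).card (a1Nodes i j w).card :=
  (Equiv.ofBijective _ (stratumOfCoords_bijective R hw)).symm

theorem stratumEquiv_symm_val (R : Type*) [CommRing R] (hw : w ∈ monotonePerms i j)
    (x : gmTimesA R (gmNodes i j w).card (a1Nodes i j w).card) :
    ((stratumEquiv R hw).symm x).1.1 = rowSpan (ofCoords i j w x.1) := rfl

theorem rowSpan_ofCoords_stratumEquiv (R : Type*) [CommRing R] (hw : w ∈ monotonePerms i j)
    (W : gaussStratum R i j w) :
    rowSpan (ofCoords i j w (stratumEquiv R hw W).1) = W.1.1 := by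
  rw [← stratumEquiv_symm_val R hw, Equiv.symm_apply_apply]

theorem stratumEquiv_natural {R' : Type*} [CommRing R'] (hw : w ∈ monotonePerms i j)
    (f : R →+* R') (W : gaussStratum R i j w) :
    ∃ W' : gaussStratum R' i j w, W'.1.1 = extendScalars f W.1.1 ∧
      (stratumEquiv R' hw W').1 = f ∘ (stratumEquiv R hw W).1 := by
  let y : gmTimesA R' (gmNodes i j w).card (a1Nodes i j w).card :=
    ⟨f ∘ (stratumEquiv R hw W).1, fun a => ((stratumEquiv R hw W).2 a).map f⟩
  refine ⟨(stratumEquiv R' hw).symm y, ?_, by rw [Equiv.apply_symm_apply]⟩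
  rw [stratumEquiv_symm_val, ← rowSpan_ofCoords_stratumEquiv R hw W, extendScalars_rowSpan,
    ofCoords_map]

end Coordinates

/-! ### Rational maps between affine spaces -/

section RationalMap

variable {K : Type*} [Field K] {ι κ : Type*}

/-- The map with the given numerators and denominators. -/
noncomputable def rationalMap (N D : κ → MvPolynomial ι K) (x : ι → K) : κ → K :=
  fun c => MvPolynomial.eval x (N c) / MvPolynomial.eval x (D c)

/-- The locus where no denominator vanishes. -/
def rationalDomain (D : κ → MvPolynomial ι K) : Set (ι → K) :=
  {x | ∀ c, MvPolynomial.eval x (D c) ≠ 0}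

/-- Clearing denominators gives one fraction valid on the whole domain, by induction on `P`. -/
theorem exists_eval_rationalMap_eq (N D : κ → MvPolynomial ι K) (P : MvPolynomial κ K) :
    ∃ a e : MvPolynomial ι K, ∀ x ∈ rationalDomain D, MvPolynomial.eval x e ≠ 0 ∧
      MvPolynomial.eval (rationalMap N D x) P =
        MvPolynomial.eval x a / MvPolynomial.eval x e := by
  induction P using MvPolynomial.induction_on with
  | C r => exact ⟨MvPolynomial.C r, 1, fun x _ => by simp⟩
  | add P Q hP hQ =>
    obtain ⟨a, e, h⟩ := hP
    obtain ⟨b, f, h'⟩ := hQ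
    refine ⟨a * f + e * b, e * f, fun x hx => ?_⟩
    obtain ⟨h1, h2⟩ := h x hx
    obtain ⟨h3, h4⟩ := h' x hx
    simp only [map_mul, map_add]
    exact ⟨mul_ne_zero h1 h3, by rw [h2, h4, div_add_div _ _ h1 h3]⟩
  | mul_X P c hP =>
    obtain ⟨a, e, h⟩ := hP
    refine ⟨a * N c, e * D c, fun x hx => ?_⟩
    obtain ⟨h1, h2⟩ := h x hx
    simp only [map_mul, MvPolynomial.eval_X]
    exact ⟨mul_ne_zero h1 (hx c), by rw [h2, rationalMap, div_mul_div_comm]⟩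

theorem isOpen_eval_ne_zero (P : MvPolynomial ι K) :
    @IsOpen _ (affineSpace K ι).top {x | MvPolynomial.eval x P ≠ 0} :=
  TopologicalSpace.isOpen_generateFrom_of_mem ⟨P, rfl⟩

theorem isOpen_rationalDomain [Finite κ] (D : κ → MvPolynomial ι K) :
    @IsOpen _ (affineSpace K ι).top (rationalDomain D) := by
  cases nonempty_fintype κ
  convert isOpen_eval_ne_zero (∏ c, D c) using 1
  ext x
  simp [rationalDomain, Finset.prod_ne_zero_iff, map_prod]

theorem isOpen_rationalMap_preimage [Finite κ] (N D : κ → MvPolynomial ι K) {V : Set (κ → K)}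
    (hV : @IsOpen _ (affineSpace K κ).top V) :
    @IsOpen _ (affineSpace K ι).top (rationalDomain D ∩ rationalMap N D ⁻¹' V) := by
  let _ : TopologicalSpace (ι → K) := (affineSpace K ι).top
  have hD : IsOpen (rationalDomain D) := isOpen_rationalDomain D
  induction hV with
  | basic V hV =>
    obtain ⟨P, rfl⟩ := hV
    obtain ⟨a, e, h⟩ := exists_eval_rationalMap_eq N D P
    convert hD.inter (isOpen_eval_ne_zero a) using 1
    ext x
    refine and_congr_right fun hx => ?_
    simp [(h x hx).2, (h x hx).1]
  | univ => simpa using hD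
  | inter V V' _ _ h h' =>
    rw [Set.preimage_inter, Set.inter_inter_distrib_left]
    exact h.inter h'
  | sUnion S _ h =>
    rw [Set.sUnion_eq_biUnion, Set.preimage_iUnion₂, Set.inter_iUnion₂]
    exact isOpen_biUnion h

theorem regularOn_comp_rationalMap (N D : κ → MvPolynomial ι K) {V : Set (κ → K)}
    {g : (κ → K) → K} (hg : (affineSpace K κ).RegularOn V g) :
    (affineSpace K ι).RegularOn (rationalDomain D ∩ rationalMap N D ⁻¹' V)
      (g ∘ rationalMap N D) := by
  rintro x ⟨hx, hxV⟩
  obtain ⟨P, Q, hQ, hPQ⟩ := hg _ hxV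
  obtain ⟨a, e, ha⟩ := exists_eval_rationalMap_eq N D P
  obtain ⟨b, f, hb⟩ := exists_eval_rationalMap_eq N D Q
  have hQb : ∀ y ∈ rationalDomain D,
      MvPolynomial.eval (rationalMap N D y) Q ≠ 0 ↔ MvPolynomial.eval y b ≠ 0 := fun y hy => by
    simp [(hb y hy).2, (hb y hy).1]
  refine ⟨a * f, e * b, ?_, ?_⟩
  · rw [map_mul]
    exact mul_ne_zero (ha x hx).1 ((hQb x hx).1 hQ)
  · rintro y ⟨hy, hyV⟩ hne
    rw [map_mul] at hne
    rw [Function.comp_apply, hPQ _ hyV ((hQb y hy).2 (right_ne_zero_of_mul hne)), (ha y hy).2,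
      (hb y hy).2, map_mul, map_mul, div_div_div_eq]

theorem regularOn_mono {U V : Set (ι → K)} {g : (ι → K) → K}
    (hg : (affineSpace K ι).RegularOn V g) (hUV : U ⊆ V) : (affineSpace K ι).RegularOn U g := by
  intro x hx
  obtain ⟨P, Q, hQ, h⟩ := hg x (hUV hx)
  exact ⟨P, Q, hQ, fun y hy => h y (hUV hy)⟩

end RationalMap

/-! ### Open sets of subspaces and quotients -/

section Subspaces

variable {K X Y : Type*}

theorem isOpen_restrict_iff {A : SpaceWithFunctions K X} {S : Set X} {U : Set S} :
    @IsOpen S (A.restrict S).top U ↔ ∃ V, @IsOpen X A.top V ∧ Subtype.val ⁻¹' V = U :=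
  Iff.rfl

theorem isOpen_quotient_iff {A : SpaceWithFunctions K X} {p : X → Y} {U : Set Y} :
    @IsOpen Y (A.quotient p).top U ↔ @IsOpen X A.top (p ⁻¹' U) :=
  Iff.rfl

end Subspaces

/-! ### The coordinates are an isomorphism of varieties -/

section Variety

variable {K : Type*} [Field K] {d n : ℕ} {i j : Fin d ↪o Fin n} {w : Equiv.Perm (Fin d)}

/-- The polynomials that describe the entries of the normal form with given coordinates. -/
noncomputable def normalFormPoly (K : Type*) [Field K] (i j : Fin d ↪o Fin n)
    (w : Equiv.Perm (Fin d)) (p : Fin d × Fin n) :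
    MvPolynomial (Fin (gmNodes i j w).card ⊕ Fin (a1Nodes i j w).card) K :=
  ofCoords i j w MvPolynomial.X p.1 p.2

theorem rationalMap_normalFormPoly
    (x : Fin (gmNodes i j w).card ⊕ Fin (a1Nodes i j w).card → K) :
    rationalMap (normalFormPoly K i j w) 1 x = fun p => ofCoords i j w x p.1 p.2 := by
  ext p
  have h := congrFun (congrFun (ofCoords_map (i := i) (j := j) (w := w)
    (x := (MvPolynomial.X : _ → MvPolynomial _ K)) (MvPolynomial.eval x)) p.1) p.2
  have hx : (MvPolynomial.eval x : MvPolynomial _ K → K) ∘ MvPolynomial.X = x := by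
    ext c
    simp
  rw [hx] at h
  rw [rationalMap, Pi.one_apply, map_one, div_one]
  exact h

theorem rationalDomain_one {ι κ : Type*} :
    rationalDomain (1 : κ → MvPolynomial ι K) = Set.univ := by
  ext x
  simp [rationalDomain]

/-- The generic `d × n` matrix. -/
noncomputable def genericMatrix (K : Type*) [Field K] (d n : ℕ) :
    Matrix (Fin d) (Fin n) (MvPolynomial (Fin d × Fin n) K) :=
  Matrix.of fun a b => MvPolynomial.X (a, b)

/-- The numerators of the coordinates on the stratum, as functions of a matrix. -/
noncomputable def coordNum (K : Type*) [Field K] (i j : Fin d ↪o Fin n)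
    (w : Equiv.Perm (Fin d)) (c : Fin (gmNodes i j w).card ⊕ Fin (a1Nodes i j w).card) :
    MvPolynomial (Fin d × Fin n) K :=
  numeratorMinor i j w (genericMatrix K d n) (nodePos i j w c).1 (nodePos i j w c).2

/-- The denominators of the coordinates on the stratum, as functions of a matrix. -/
noncomputable def coordDen (K : Type*) [Field K] (i j : Fin d ↪o Fin n)
    (w : Equiv.Perm (Fin d)) (c : Fin (gmNodes i j w).card ⊕ Fin (a1Nodes i j w).card) :
    MvPolynomial (Fin d × Fin n) K :=
  denominatorMinor i j w (genericMatrix K d n) (nodePos i j w c).1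

theorem eval_genericMatrix (x : Fin d × Fin n → K) :
    (genericMatrix K d n).map (MvPolynomial.eval x) = Matrix.of fun a b => x (a, b) := by
  ext a b
  simp [genericMatrix]

theorem eval_det_genericMatrix (x : Fin d × Fin n → K) (c : Fin d → Fin n) :
    MvPolynomial.eval x ((genericMatrix K d n).submatrix id c).det =
      ((Matrix.of fun a b => x (a, b)).submatrix id c).det := by
  rw [RingHom.map_det, RingHom.mapMatrix_apply, ← Matrix.submatrix_map, eval_genericMatrix]

theorem eval_coordNum (x : Fin d × Fin n → K)
    (c : Fin (gmNodes i j w).card ⊕ Fin (a1Nodes i j w).card) :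
    MvPolynomial.eval x (coordNum K i j w c) = numeratorMinor i j w
      (Matrix.of fun a b => x (a, b)) (nodePos i j w c).1 (nodePos i j w c).2 :=
  eval_det_genericMatrix x _

theorem eval_coordDen (x : Fin d × Fin n → K)
    (c : Fin (gmNodes i j w).card ⊕ Fin (a1Nodes i j w).card) :
    MvPolynomial.eval x (coordDen K i j w c) = denominatorMinor i j w
      (Matrix.of fun a b => x (a, b)) (nodePos i j w c).1 :=
  eval_det_genericMatrix x _

/-- Changing the matrix by a factor `g` multiplies numerators and denominators by the same `det g`,
so the quotients descend to the Grassmannian. -/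
theorem coords_congr {x y : fullRank K d n}
    (h : fullRankToGrassmannian K d n x = fullRankToGrassmannian K d n y) :
    (x.1 ∈ rationalDomain (coordDen K i j w) → y.1 ∈ rationalDomain (coordDen K i j w)) ∧
      rationalMap (coordNum K i j w) (coordDen K i j w) x.1 =
        rationalMap (coordNum K i j w) (coordDen K i j w) y.1 := by
  have h' : rowSpan (Matrix.of fun a b => x.1 (a, b)) = rowSpan (Matrix.of fun a b => y.1 (a, b)) :=
    congrArg Subtype.val h
  obtain ⟨g, hg⟩ := rowSpan_le_iff.1 h'.le
  obtain ⟨g', hg'⟩ := rowSpan_le_iff.1 h'.ge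
  constructor
  · intro hx c hy
    apply hx c
    rw [eval_coordDen] at hy ⊢
    rw [hg, denominatorMinor_mul, hy, mul_zero]
  · ext c
    simp only [rationalMap, eval_coordNum, eval_coordDen]
    -- In this case both denominators vanish, and both quotients are `0` by convention.
    by_cases hu : g.det = 0
    · have h0 : denominatorMinor i j w (Matrix.of fun a b => x.1 (a, b)) (nodePos i j w c).1 = 0 := by
        rw [hg, denominatorMinor_mul, hu, zero_mul]
      have h1 : denominatorMinor i j w (Matrix.of fun a b => y.1 (a, b)) (nodePos i j w c).1 = 0 := by
        rw [hg', denominatorMinor_mul, h0, mul_zero]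
      rw [h0, h1, div_zero, div_zero]
    · rw [hg, denominatorMinor_mul, numeratorMinor_mul, mul_div_mul_left _ _ hu]

/-- The coordinates of a point of the stratum are given by quotients of minors. -/
theorem coords_of_mem_stratum (hw : w ∈ monotonePerms i j) (W : gaussStratum K i j w)
    {x : fullRank K d n} (hx : fullRankToGrassmannian K d n x = W.1) :
    x.1 ∈ rationalDomain (coordDen K i j w) ∧
      rationalMap (coordNum K i j w) (coordDen K i j w) x.1 = (stratumEquiv K hw W).1 := by
  have hZ := isNormalForm_ofCoords hw (stratumEquiv K hw W).2
  have h : rowSpan (Matrix.of fun a b => x.1 (a, b)) =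
      rowSpan (ofCoords i j w (stratumEquiv K hw W).1) := by
    rw [rowSpan_ofCoords_stratumEquiv, ← hx]
    rfl
  have key := hZ.apply_mul_denominatorMinor h
  constructor
  · intro c
    rw [eval_coordDen]
    exact (key _ (nodePos i j w c).2).1.ne_zero
  · ext c
    obtain ⟨h1, h2⟩ := key (nodePos i j w c).1 (nodePos i j w c).2
    rw [rationalMap, eval_coordNum, eval_coordDen, ← h2, ofCoords_nodePos,
      mul_div_cancel_right₀ _ h1.ne_zero]

theorem ofCoords_mem_fullRank (hw : w ∈ monotonePerms i j)
    (x : gmTimesA K (gmNodes i j w).card (a1Nodes i j w).card) :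
    (fun p => ofCoords i j w x.1 p.1 p.2) ∈ fullRank K d n :=
  linearIndependent_rows _ i (isNormalForm_ofCoords hw x.2).isUnit_det

theorem fullRankToGrassmannian_ofCoords (hw : w ∈ monotonePerms i j)
    (x : gmTimesA K (gmNodes i j w).card (a1Nodes i j w).card) :
    fullRankToGrassmannian K d n ⟨_, ofCoords_mem_fullRank hw x⟩ =
      ((stratumEquiv K hw).symm x).1 := rfl

theorem fullRankToGrassmannian_ofCoords_stratumEquiv (hw : w ∈ monotonePerms i j)
    (W : gaussStratum K i j w) :
    fullRankToGrassmannian K d n ⟨_, ofCoords_mem_fullRank hw (stratumEquiv K hw W)⟩ = W.1 := by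
  rw [fullRankToGrassmannian_ofCoords hw, Equiv.symm_apply_apply]

/-- The subset of the Grassmannian where the coordinates are defined and lie in `V`. -/
def coordsPreimage (i j : Fin d ↪o Fin n) (w : Equiv.Perm (Fin d))
    (V : Set (Fin (gmNodes i j w).card ⊕ Fin (a1Nodes i j w).card → K)) :
    Set (Grassmannian K d n) :=
  {W | ∃ x : fullRank K d n, fullRankToGrassmannian K d n x = W ∧
    x.1 ∈ rationalDomain (coordDen K i j w) ∩
      rationalMap (coordNum K i j w) (coordDen K i j w) ⁻¹' V}

/-- The condition is independent of the representing matrix, so openness can be tested upstairs. -/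
theorem fullRankToGrassmannian_mem_coordsPreimage
    {V : Set (Fin (gmNodes i j w).card ⊕ Fin (a1Nodes i j w).card → K)} {x : fullRank K d n} :
    fullRankToGrassmannian K d n x ∈ coordsPreimage i j w V ↔
      x.1 ∈ rationalDomain (coordDen K i j w) ∩
        rationalMap (coordNum K i j w) (coordDen K i j w) ⁻¹' V := by
  constructor
  · rintro ⟨y, hy, hyD, hyV⟩
    obtain ⟨h1, h2⟩ := coords_congr (i := i) (j := j) (w := w) hy
    exact ⟨h1 hyD, by rw [Set.mem_preimage, ← h2]; exact hyV⟩
  · exact fun h => ⟨x, rfl, h⟩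

theorem mem_coordsPreimage_iff (hw : w ∈ monotonePerms i j) (W : gaussStratum K i j w)
    {V : Set (Fin (gmNodes i j w).card ⊕ Fin (a1Nodes i j w).card → K)} :
    W.1 ∈ coordsPreimage i j w V ↔ (stratumEquiv K hw W).1 ∈ V := by
  have h := fullRankToGrassmannian_ofCoords_stratumEquiv hw W
  obtain ⟨h1, h2⟩ := coords_of_mem_stratum hw W h
  rw [← h, fullRankToGrassmannian_mem_coordsPreimage, Set.mem_inter_iff, Set.mem_preimage, h2]
  exact and_iff_right h1

theorem isOpen_coordsPreimage
    {V : Set (Fin (gmNodes i j w).card ⊕ Fin (a1Nodes i j w).card → K)}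
    (hV : @IsOpen _ (affineSpace K _).top V) :
    @IsOpen _ (grassmannianVariety K d n).top (coordsPreimage i j w V) := by
  refine isOpen_quotient_iff.2 (isOpen_restrict_iff.2 ⟨_, isOpen_rationalMap_preimage
    (coordNum K i j w) (coordDen K i j w) hV, ?_⟩)
  ext x
  exact fullRankToGrassmannian_mem_coordsPreimage.symm

theorem isIsomorphism_stratumEquiv (hw : w ∈ monotonePerms i j) :
    IsIsomorphism (gaussStratumVariety K i j w)
      (gmTimesAVariety K (gmNodes i j w).card (a1Nodes i j w).card) (stratumEquiv K hw) := by
  have hpull : ∀ {O : Set (Fin d × Fin n → K)}, @IsOpen _ (affineSpace K _).top O →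
      @IsOpen _ (affineSpace K _).top {x | (fun p => ofCoords i j w x p.1 p.2) ∈ O} := by
    intro O hO
    have := isOpen_rationalMap_preimage (normalFormPoly K i j w) 1 hO
    rw [rationalDomain_one, Set.univ_inter] at this
    convert this using 1
    ext x
    rw [Set.mem_preimage, rationalMap_normalFormPoly]
    rfl
  have hpullreg : ∀ {O : Set (Fin d × Fin n → K)} {g}, (affineSpace K _).RegularOn O g →
      (affineSpace K _).RegularOn {x | (fun p => ofCoords i j w x p.1 p.2) ∈ O}
        (fun x => g fun p => ofCoords i j w x p.1 p.2) := by
    intro O g hg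
    have := regularOn_comp_rationalMap (normalFormPoly K i j w) 1 hg
    rw [rationalDomain_one, Set.univ_inter] at this
    have hfun : rationalMap (normalFormPoly K i j w) 1 =
        fun x p => ofCoords i j w x p.1 p.2 := funext rationalMap_normalFormPoly
    rw [hfun] at this
    exact this
  constructor
  · intro U
    constructor
    · rintro ⟨V, hV, rfl⟩
      refine isOpen_restrict_iff.2 ⟨_, isOpen_coordsPreimage hV, ?_⟩
      ext W
      exact mem_coordsPreimage_iff hw W
    · rintro ⟨V, hV, hVU⟩
      obtain ⟨O, hO, hOV⟩ := hV
      refine isOpen_restrict_iff.2 ⟨_, hpull hO, ?_⟩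
      ext x
      have h1 := Set.ext_iff.1 hOV ⟨_, ofCoords_mem_fullRank hw x⟩
      have h2 := Set.ext_iff.1 hVU ((stratumEquiv K hw).symm x)
      rw [Set.mem_preimage, Set.mem_preimage, fullRankToGrassmannian_ofCoords hw] at h1
      rw [Set.mem_preimage, Set.mem_preimage, Equiv.apply_symm_apply] at h2
      exact h1.trans h2
  · intro U _ f
    constructor
    · intro hf W hW
      obtain ⟨V, g, hV, hWV, hg, hfg⟩ := hf _ hW
      -- A local extension of `f` to the Grassmannian is obtained by descending `g` of the quotients
      -- of minors.
      have hfac : Function.FactorsThrough (fun x : fullRank K d n =>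
          g (rationalMap (coordNum K i j w) (coordDen K i j w) x.1))
          (fullRankToGrassmannian K d n) := fun x y h =>
        congrArg g (coords_congr h).2
      refine ⟨coordsPreimage i j w V, Function.extend (fullRankToGrassmannian K d n)
        (fun x => g (rationalMap (coordNum K i j w) (coordDen K i j w) x.1)) 0,
        isOpen_coordsPreimage hV, (mem_coordsPreimage_iff hw W).2 hWV, ?_, ?_⟩
      · intro x hx
        refine ⟨_, _, isOpen_rationalMap_preimage (coordNum K i j w) (coordDen K i j w) hV,
          fullRankToGrassmannian_mem_coordsPreimage.1 hx,
          regularOn_comp_rationalMap (coordNum K i j w) (coordDen K i j w) hg, ?_⟩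
        intro y _ _
        rw [Function.comp_apply, hfac.extend_apply]
        rfl
      · intro W' hW' hW'V
        have h := fullRankToGrassmannian_ofCoords_stratumEquiv hw W'
        have h2 := (coords_of_mem_stratum hw W' h).2
        rw [Function.comp_apply, hfg _ hW' ((mem_coordsPreimage_iff hw W').1 hW'V), ← h2]
        conv_rhs => rw [← h, hfac.extend_apply]
    · intro hf x hx
      obtain ⟨V, g, ⟨O, hO, hOV⟩, hWV, hg, hfg⟩ := hf ((stratumEquiv K hw).symm x)
        (by rwa [Set.mem_preimage, Equiv.apply_symm_apply])
      -- Regularity on the Grassmannian is regularity on matrices; it is tested at the normal form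
      -- and pulled back along the polynomial section.
      obtain ⟨O', g', hO', hxO', hg', hgg'⟩ := hg ⟨_, ofCoords_mem_fullRank hw x⟩ hWV
      have hxO : (fun p => ofCoords i j w x.1 p.1 p.2) ∈ O :=
        (Set.ext_iff.1 hOV ⟨_, ofCoords_mem_fullRank hw x⟩).2 hWV
      refine ⟨_, _, hpull ((affineSpace K _).top.isOpen_inter O O' hO hO'), ⟨hxO, hxO'⟩,
        hpullreg (regularOn_mono hg' Set.inter_subset_right), ?_⟩
      rintro z hz ⟨hzO, hzO'⟩
      have hzV := (Set.ext_iff.1 hOV ⟨_, ofCoords_mem_fullRank hw z⟩).1 hzO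
      have h1 := hfg ((stratumEquiv K hw).symm z)
        (by rwa [Set.mem_preimage, Equiv.apply_symm_apply]) hzV
      rw [Function.comp_apply, Equiv.apply_symm_apply] at h1
      exact h1.trans (hgg' ⟨_, ofCoords_mem_fullRank hw z⟩ hzV hzO')

end Variety

end GaussStrata

theorem mainTheorem9 {K : Type u} [Field K] {d n : ℕ} (i j : Fin d ↪o Fin n)
    (w : Equiv.Perm (Fin d)) (hw : w ∈ GaussStrata.monotonePerms i j) :
    ∃ Φ : ∀ (R : Type u) [CommRing R] [Algebra K R],
        GaussStrata.gaussStratum R i j w ≃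
          GaussStrata.gmTimesA R (GaussStrata.gmNodes i j w).card
            (GaussStrata.a1Nodes i j w).card,
      -- the bijections are natural in the `K`-algebra, so they define an isomorphism of functors
      (∀ (R R' : Type u) [CommRing R] [Algebra K R] [CommRing R'] [Algebra K R']
        (f : R →ₐ[K] R') (W : GaussStrata.gaussStratum R i j w),
        ∃ W' : GaussStrata.gaussStratum R' i j w,
          W'.1.1 = GaussStrata.extendScalars (f : R →+* R') W.1.1 ∧
          (Φ R' W').1 = f ∘ (Φ R W).1) ∧
      -- the bijection on `K`-points is an isomorphism of classical varieties
      GaussStrata.IsIsomorphism (GaussStrata.gaussStratumVariety K i j w)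
        (GaussStrata.gmTimesAVariety K (GaussStrata.gmNodes i j w).card
          (GaussStrata.a1Nodes i j w).card) (Φ K) := by
  exact ⟨fun R _ _ => GaussStrata.stratumEquiv R hw,
    fun R R' _ _ _ _ f W => GaussStrata.stratumEquiv_natural hw (f : R →+* R') W,
    GaussStrata.isIsomorphism_stratumEquiv hw⟩
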